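/- Graphs are in the sense of Serre: a graph has vertices, arcs, origin and terminus maps $o,t$ and an involution $a\mapsto\bar a$ on arcs with $o(a)=t(\bar a)$; loops, parallel arcs and self-reverse arcs ($\bar a=a$) are allowed. Graph morphisms commute with $o$, $t$ and reversal. A tree is a simple connected non-empty graph without cycles. **Local action diagrams.** A local action diagram consists of a connected graph $\Gamma$, a set $X(a)$ for every arc $a$, and for every vertex $v$ a subgroup $G(v)\le \mathrm{Sym}(X(v))$, where $X(v)=\bigsqcup_{t(a)=v}X(a)$, such that each $X(a)$ with $t(a)=v$ is an orbit of $G(v)$. (The groups $G(v)$ need not be closed.) Its tree is a tree $T$ with a surjective graph morphism $\pi:T\to\Gamma$ and a map $\mathcal L$ from the arcs of $T$ to $\bigsqcup_a X(a)$ which, for every vertex $v$ of $T$ and every arc $a$ of $\Gamma$ with $t(a)=\pi(v)$, restricts to a bijection $\{b: t(b)=v,\ \pi(b)=a\}\to X(a)$. Its universal group consists of all automorphisms $g$ of $T$ with $\pi g=\pi$ such that for every vertex $v$ of $T$ the permutation $\mathcal L_{g(v)}\,g\,\mathcal L_v^{-1}$ of $X(\pi(v))$ lies in $G(\pi(v))$,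 where $\mathcal L_v$ is the restriction of $\mathcal L$ to the arcs with terminus $v$. **Graphs of group actions.** A graph of group actions (gga) $\mathcal G$ consists of a connected base graph $\Delta$; for every vertex $v$ a permutation group $G(v)$ on a non-empty set $X(v)$; for every arc $a$ a permutation group $H(a)$ on a non-empty set $Y(a)$, the same for $a$ and $\bar a$, and an injection $\Phi_a:Y(a)\to X(t(a))$ which carries $H(a)$ exactly onto the permutation group induced on $\Phi_a(Y(a))$ by its setwise stabiliser in $G(t(a))$; and for every self-reverse arc $a$ a permutation $h_a$ of $Y(a)$ with $h_aH(a)h_a^{-1}=H(a)$ and $h_a^2\in H(a)$. It is free if every $Y(a)$ has exactly one element (and so every $H(a)$ is trivial). An $a$-adhesion map is a map $\gamma\Phi_a$, a twisted $a$-adhesion map (for $a$ self-reverse) is a map $\gamma\Phi_ah_a$, and an $a$-adhesion set is a set $\gamma\Phi_a(Y(a))$, with $\gamma\in G(t(a))$. A scaffolding for $\mathcal G$ is a graph $\Sigma$ with an equivalence relation $\sim$ on its vertices, extended to arcs by $a\sim b\iff o(a)\sim o(b)$ and $t(a)\sim t(b)$, such that: the quotient $T_\Sigma=\Sigma/{\sim}$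 is a tree; no arc of $\Sigma$ joins equivalent vertices; there are a graph morphism $\pi:T_\Sigma\to\Delta$ and a colouring $p$ which restricts to bijections $[v]\to X(\pi[v])$ and $[a]\to Y(\pi[a])$ on the classes of vertices and arcs, and satisfies $p(\bar b)=p(b)$ for arcs $b$; if $\Psi_{[a]}:Y(\pi[a])\to X(\pi(t[a]))$ denotes the map with $\Psi_{[a]}(p(b))=p(t(b))$ for $b\in[a]$, then $\Psi_{[a]}$ is a $\pi[a]$-adhesion map when $\pi[a]$ is not self-reverse, and when $\pi[a]$ is self-reverse one of $\Psi_{[a]},\Psi_{[\bar a]}$ is a $\pi[a]$-adhesion map and the other a twisted one; and for every vertex $[v]$ of $T_\Sigma$, every arc $b$ of $\Delta$ with $t(b)=\pi[v]$ and every $b$-adhesion set $S$ there is exactly one arc $[a]$ of $T_\Sigma$ with $t[a]=[v]$, $\pi[a]=b$ and $\Psi_{[a]}(Y(b))=S$. The universal group $\mathcal U(\mathcal G)$ consists of all automorphisms $g$ of $\Sigma$ which preserve $\sim$ and $\pi$ and for which, for every $[v]$, the permutation $\gamma$ of $X(\pi[v])$ with $p(g(w))=\gamma(p(w))$ for all $w\in[v]$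 lies in $G(\pi[v])$. It acts on $T_\Sigma$, the associated tree of $\mathcal G$. An isomorphism of actions of groups $G,K$ on trees $T,T'$ by an isomorphism of the trees is a pair of a group isomorphism $\varphi:G\to K$ and a graph isomorphism $\Phi:T\to T'$ with $\Phi(gx)=\varphi(g)\Phi(x)$ for all $g\in G$ and all vertices and arcs $x$ of $T$. **Proposition.** Let $G$ be a group acting faithfully by automorphisms on a tree $T$. The following are equivalent: 1. the action of $G$ on $T$ is isomorphic, by an isomorphism of the trees, to the action of the universal group of some local action diagram on its tree; 2. the action of $G$ on $T$ is isomorphic, by an isomorphism of the trees, to the action of the universal group $\mathcal U(\mathcal G)$ of some free gga $\mathcal G$ on its associated tree; 3. the action of $G$ on $T$ is isomorphic, by an isomorphism of the trees, to the action on the associated tree of some free gga $\mathcal G$ of the group of tree automorphisms induced by $\mathcal U(\mathcal G)$. -/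

import Mathlib

universe u v w

/-- A graph in the sense of Serre: vertices, arcs, origin, terminus, and an involutive reversal of
arcs.  Loops, parallel arcs and self-reverse arcs (`rev a = a`) are allowed. -/
structure SerreGraph : Type (u + 1) where
  V : Type u
  A : Type u
  o : A → V
  t : A → V
  rev : A → A
  rev_rev : ∀ a, rev (rev a) = a
  o_eq : ∀ a, o a = t (rev a)

namespace SerreGraph

theorem t_eq (Γ : SerreGraph.{u}) (a : Γ.A) : Γ.t a = Γ.o (Γ.rev a) := by
  rw [Γ.o_eq, Γ.rev_rev]

/-- The underlying simple graph. -/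
def toSimple (Γ : SerreGraph.{u}) : SimpleGraph Γ.V where
  Adj x y := x ≠ y ∧ ∃ a, Γ.o a = x ∧ Γ.t a = y
  symm := ⟨by
    rintro x y ⟨hne, a, rfl, rfl⟩
    exact ⟨hne.symm, Γ.rev a, (Γ.t_eq a).symm, (Γ.o_eq a).symm⟩⟩
  loopless := ⟨fun _ h => h.1 rfl⟩

/-- A non-empty graph any two of whose vertices are joined by a path. -/
def IsConnected (Γ : SerreGraph.{u}) : Prop := Γ.toSimple.Connected

/-- No loops and no parallel arcs. -/
def IsSimple (Γ : SerreGraph.{u}) : Prop :=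
  (∀ a, Γ.o a ≠ Γ.t a) ∧ Function.Injective (fun a => (Γ.o a, Γ.t a))

/-- A tree: a simple connected graph without cycles. -/
def IsTree (Γ : SerreGraph.{u}) : Prop := Γ.IsSimple ∧ Γ.toSimple.IsTree

/-- Two arcs belong to the same edge when they are equal or reverse to each other. -/
def edgeSetoid (Γ : SerreGraph.{u}) : Setoid Γ.A where
  r a b := b = a ∨ b = Γ.rev a
  iseqv :=
    { refl := fun _ => Or.inl rfl
      symm := by
        rintro a b (rfl | rfl)
        · exact Or.inl rfl
        · exact Or.inr (Γ.rev_rev a).symm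
      trans := by
        rintro a b c (rfl | rfl) (rfl | rfl)
        · exact Or.inl rfl
        · exact Or.inr rfl
        · exact Or.inr rfl
        · exact Or.inl (Γ.rev_rev a) }

/-- The edges `{a, rev a}` of a graph. -/
def Edge (Γ : SerreGraph.{u}) : Type u := Quotient Γ.edgeSetoid

/-- The edge to which an arc belongs. -/
def edge (Γ : SerreGraph.{u}) (a : Γ.A) : Γ.Edge := Quotient.mk Γ.edgeSetoid a

theorem edge_rev (Γ : SerreGraph.{u}) (a : Γ.A) : Γ.edge (Γ.rev a) = Γ.edge a :=
  Quotient.sound (s := Γ.edgeSetoid) (Or.inr (Γ.rev_rev a).symm)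

/-- Graph morphisms. -/
structure Hom (Γ : SerreGraph.{u}) (Δ : SerreGraph.{v}) where
  onV : Γ.V → Δ.V
  onA : Γ.A → Δ.A
  map_o : ∀ a, onV (Γ.o a) = Δ.o (onA a)
  map_t : ∀ a, onV (Γ.t a) = Δ.t (onA a)
  map_rev : ∀ a, onA (Γ.rev a) = Δ.rev (onA a)

/-- Graph isomorphisms: morphisms that are bijective on vertices and on arcs. -/
@[ext]
structure Iso (Γ : SerreGraph.{u}) (Δ : SerreGraph.{v}) where
  onV : Γ.V ≃ Δ.V
  onA : Γ.A ≃ Δ.A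
  map_o : ∀ a, onV (Γ.o a) = Δ.o (onA a)
  map_t : ∀ a, onV (Γ.t a) = Δ.t (onA a)
  map_rev : ∀ a, onA (Γ.rev a) = Δ.rev (onA a)

/-- Automorphisms of a graph. -/
abbrev Aut (Γ : SerreGraph.{u}) : Type u := Iso Γ Γ

/-- Automorphisms form a group under composition. -/
instance (Γ : SerreGraph.{u}) : Group Γ.Aut where
  mul g h :=
    { onV := h.onV.trans g.onV
      onA := h.onA.trans g.onA
      map_o := fun a => by simp [h.map_o, g.map_o]
      map_t := fun a => by simp [h.map_t, g.map_t]
      map_rev := fun a => by simp [h.map_rev, g.map_rev] }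
  one :=
    { onV := Equiv.refl _
      onA := Equiv.refl _
      map_o := fun _ => rfl
      map_t := fun _ => rfl
      map_rev := fun _ => rfl }
  inv g :=
    { onV := g.onV.symm
      onA := g.onA.symm
      map_o := fun a => by rw [Equiv.symm_apply_eq, g.map_o, Equiv.apply_symm_apply]
      map_t := fun a => by rw [Equiv.symm_apply_eq, g.map_t, Equiv.apply_symm_apply]
      map_rev := fun a => by rw [Equiv.symm_apply_eq, g.map_rev, Equiv.apply_symm_apply] }
  mul_assoc _ _ _ := rfl
  one_mul _ := rfl
  mul_one _ := rfl
  inv_mul_cancel g := Iso.ext (Equiv.self_trans_symm g.onV) (Equiv.self_trans_symm g.onA)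

section AutLemmas

variable {Γ : SerreGraph.{u}} (g h : Γ.Aut)

@[simp] theorem one_onV (x : Γ.V) : (1 : Γ.Aut).onV x = x := rfl

@[simp] theorem one_onA (a : Γ.A) : (1 : Γ.Aut).onA a = a := rfl

@[simp] theorem mul_onV (x : Γ.V) : (g * h).onV x = g.onV (h.onV x) := rfl

@[simp] theorem mul_onA (a : Γ.A) : (g * h).onA a = g.onA (h.onA a) := rfl

@[simp] theorem onV_inv (x : Γ.V) : g.onV (g⁻¹.onV x) = x := g.onV.apply_symm_apply x

@[simp] theorem onA_inv (a : Γ.A) : g.onA (g⁻¹.onA a) = a := g.onA.apply_symm_apply a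

@[simp] theorem inv_onV (x : Γ.V) : g⁻¹.onV (g.onV x) = x := g.onV.symm_apply_apply x

@[simp] theorem inv_onA (a : Γ.A) : g⁻¹.onA (g.onA a) = a := g.onA.symm_apply_apply a

end AutLemmas

/-- The extension of an equivalence relation on vertices to arcs: two arcs are equivalent when
their origins and their termini are. -/
def arcSetoid (Γ : SerreGraph.{u}) (r : Setoid Γ.V) : Setoid Γ.A where
  r a b := r (Γ.o a) (Γ.o b) ∧ r (Γ.t a) (Γ.t b)
  iseqv :=
    { refl := fun _ => ⟨r.refl _, r.refl _⟩
      symm := fun h => ⟨r.symm h.1, r.symm h.2⟩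
      trans := fun h k => ⟨r.trans h.1 k.1, r.trans h.2 k.2⟩ }

/-- The quotient graph by an equivalence relation on vertices, extended to arcs as above. -/
def quot (Γ : SerreGraph.{u}) (r : Setoid Γ.V) : SerreGraph.{u} where
  V := Quotient r
  A := Quotient (Γ.arcSetoid r)
  o := Quotient.lift (fun a => Quotient.mk r (Γ.o a)) (fun _ _ h => Quotient.sound h.1)
  t := Quotient.lift (fun a => Quotient.mk r (Γ.t a)) (fun _ _ h => Quotient.sound h.2)
  rev := Quotient.map Γ.rev (fun a b h => by
    refine ⟨?_, ?_⟩
    · rw [← Γ.t_eq, ← Γ.t_eq]; exact h.2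
    · rw [← Γ.o_eq, ← Γ.o_eq]; exact h.1)
  rev_rev := by
    rintro ⟨a⟩
    exact congrArg (Quotient.mk (Γ.arcSetoid r)) (Γ.rev_rev a)
  o_eq := by
    rintro ⟨a⟩
    exact congrArg (Quotient.mk r) (Γ.o_eq a)

/-- The class of a vertex, as a vertex of the quotient graph. -/
def clsV (Γ : SerreGraph.{u}) (r : Setoid Γ.V) (x : Γ.V) : (Γ.quot r).V := Quotient.mk r x

/-- The class of an arc, as an arc of the quotient graph. -/
def clsA (Γ : SerreGraph.{u}) (r : Setoid Γ.V) (a : Γ.A) : (Γ.quot r).A :=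
  Quotient.mk (Γ.arcSetoid r) a

/-- An automorphism that preserves an equivalence relation acts on the quotient graph. -/
def quotAut (Γ : SerreGraph.{u}) (r : Setoid Γ.V) (g : Γ.Aut)
    (hg : ∀ x y, r x y ↔ r (g.onV x) (g.onV y)) : (Γ.quot r).Aut where
  onV := Quotient.congr g.onV hg
  onA := Quotient.congr g.onA (fun a b => by
    change (r _ _ ∧ r _ _) ↔ (r _ _ ∧ r _ _)
    rw [← g.map_o, ← g.map_o, ← g.map_t, ← g.map_t, ← hg, ← hg])
  map_o := by
    rintro ⟨a⟩
    exact congrArg (Quotient.mk r) (g.map_o a)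
  map_t := by
    rintro ⟨a⟩
    exact congrArg (Quotient.mk r) (g.map_t a)
  map_rev := by
    rintro ⟨a⟩
    exact congrArg (Quotient.mk (Γ.arcSetoid r)) (g.map_rev a)

/-- Two actions by automorphisms on graphs are isomorphic by a graph isomorphism: there are a group
isomorphism `φ` and a graph isomorphism `Φ` with `Φ (g x) = φ(g) (Φ x)` for all vertices and
arcs `x`. -/
def ActionIso {G : Type v} {K : Type w} [Group G] [Group K] {S T : SerreGraph.{u}}
    (ρ : G →* S.Aut) (σ : K →* T.Aut) : Prop :=
  ∃ (φ : G ≃* K) (Φ : S.Iso T),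
    (∀ g x, Φ.onV ((ρ g).onV x) = (σ (φ g)).onV (Φ.onV x)) ∧
    (∀ g a, Φ.onA ((ρ g).onA a) = (σ (φ g)).onA (Φ.onA a))

end SerreGraph

/-! ### Local action diagrams -/

/-- A local action diagram: a connected graph `Γ`, a set `X a` for each arc, and for each vertex
`v` a group `G v` of permutations of the disjoint union of the sets `X a` with `t a = v`, whose
orbits are precisely these sets `X a`. -/
structure LocalActionDiagram : Type (u + 1) where
  Γ : SerreGraph.{u}
  connected : Γ.IsConnected
  X : Γ.A → Type u
  G : ∀ v : Γ.V, Subgroup (Equiv.Perm (Σ a : {a : Γ.A // Γ.t a = v}, X a.1))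
  orbit : ∀ (v : Γ.V) (a : {a : Γ.A // Γ.t a = v}),
    ∃ x, MulAction.orbit (G v) x = {z : Σ a : {a : Γ.A // Γ.t a = v}, X a.1 | z.1 = a}

namespace LocalActionDiagram

/-- The set `X(v)`, the disjoint union of the `X a` over the arcs `a` with terminus `v`. -/
abbrev XV (D : LocalActionDiagram.{u}) (v : D.Γ.V) : Type u :=
  Σ a : {a : D.Γ.A // D.Γ.t a = v}, D.X a.1

/-- The inclusion of `X(v)` into the disjoint union of all sets `X a`. -/
def incl (D : LocalActionDiagram.{u}) {v : D.Γ.V} (z : D.XV v) : Σ a : D.Γ.A, D.X a :=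
  ⟨z.1.1, z.2⟩

/-- A tree of a local action diagram: a tree `T`, a surjective graph morphism `π : T → Γ`, and a
labelling `L` of the arcs of `T` which, for every vertex `v` of `T` and every arc `a` of `Γ` with
`t a = π v`, restricts to a bijection from the arcs over `a` with terminus `v` onto `X a`. -/
structure Tree (D : LocalActionDiagram.{u}) where
  T : SerreGraph.{u}
  isTree : T.IsTree
  π : T.Hom D.Γ
  surjV : Function.Surjective π.onV
  surjA : Function.Surjective π.onA
  L : T.A → Σ a : D.Γ.A, D.X a
  bij : ∀ (v : T.V) (a : D.Γ.A), D.Γ.t a = π.onV v →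
    Set.BijOn L {b | T.t b = v ∧ π.onA b = a} {x | x.1 = a}

/-- The universal group of a local action diagram: the automorphisms `g` of its tree with
`π g = π` such that, for each vertex `v` of the tree, the permutation `γ` of `X(π v)` which sends
the label of each arc `b` ending in `v` to the label of `g b` lies in `G(π v)`. -/
def Tree.universalGroup {D : LocalActionDiagram.{u}} (S : D.Tree) : Subgroup S.T.Aut where
  carrier := {g | (∀ v, S.π.onV (g.onV v) = S.π.onV v) ∧ (∀ a, S.π.onA (g.onA a) = S.π.onA a) ∧
    ∀ (v : S.T.V) (i : D.Γ.V), S.π.onV v = i →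
      ∃ γ ∈ D.G i, ∀ (b : S.T.A) (x : D.XV i), S.T.t b = v → S.L b = D.incl x →
        S.L (g.onA b) = D.incl (γ x)}
  one_mem' := ⟨fun _ => rfl, fun _ => rfl, fun _ i _ => ⟨1, (D.G i).one_mem, fun _ _ _ h => h⟩⟩
  mul_mem' := by
    rintro g h ⟨g1, g2, g3⟩ ⟨h1, h2, h3⟩
    refine ⟨fun v => by simp [g1, h1], fun a => by simp [g2, h2], fun v i hv => ?_⟩
    obtain ⟨γ, hγ, hγ'⟩ := h3 v i hv
    obtain ⟨δ, hδ, hδ'⟩ := g3 (h.onV v) i (by rw [h1, hv])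
    refine ⟨δ * γ, (D.G i).mul_mem hδ hγ, fun b x hb hx => ?_⟩
    exact hδ' _ _ (by rw [← h.map_t, hb]) (hγ' b x hb hx)
  inv_mem' := by
    rintro g ⟨g1, g2, g3⟩
    have k1 : ∀ v, S.π.onV (g⁻¹.onV v) = S.π.onV v := fun v => by
      rw [← g1 (g⁻¹.onV v), SerreGraph.onV_inv]
    have k2 : ∀ a, S.π.onA (g⁻¹.onA a) = S.π.onA a := fun a => by
      rw [← g2 (g⁻¹.onA a), SerreGraph.onA_inv]
    refine ⟨k1, k2, fun v i hv => ?_⟩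
    obtain ⟨γ, hγ, hγ'⟩ := g3 (g⁻¹.onV v) i (by rw [k1, hv])
    refine ⟨γ⁻¹, (D.G i).inv_mem hγ, fun b x hb hx => ?_⟩
    -- the label of `g⁻¹ b` is some `y`, and `γ y = x`
    have hb' : S.T.t (g⁻¹.onA b) = g⁻¹.onV v := by rw [← hb, g⁻¹.map_t]
    have hmem := (S.bij (S.T.t (g⁻¹.onA b)) (S.π.onA (g⁻¹.onA b)) (S.π.map_t _).symm).1
      ⟨rfl, rfl⟩
    have ht : D.Γ.t (S.L (g⁻¹.onA b)).1 = i := by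
      rw [show (S.L (g⁻¹.onA b)).1 = S.π.onA (g⁻¹.onA b) from hmem, ← S.π.map_t, hb', k1, hv]
    have h := hγ' (g⁻¹.onA b) ⟨⟨_, ht⟩, (S.L (g⁻¹.onA b)).2⟩ hb' rfl
    rw [SerreGraph.onA_inv, hx] at h
    have hinj : Function.Injective (D.incl (v := i)) := by
      rintro ⟨⟨a, ha⟩, x⟩ ⟨⟨b, hb⟩, y⟩ hxy
      simp only [incl, Sigma.mk.injEq] at hxy
      obtain ⟨rfl, hxy⟩ := hxy
      obtain rfl := eq_of_heq hxy
      rfl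
    rw [hinj h]
    exact congrArg D.incl
      (γ.symm_apply_apply (⟨⟨(S.L (g⁻¹.onA b)).1, ht⟩, (S.L (g⁻¹.onA b)).2⟩ : D.XV i)).symm

end LocalActionDiagram

/-! ### Graphs of group actions -/

/-- An injection `Φ : Y → X` is an embedding of the permutation group `H` on `Y` into the
permutation group `G` on `X` when it carries `H` precisely onto the permutation group induced on
`Φ(Y)` by the setwise stabiliser of `Φ(Y)` in `G`. -/
def IsActionEmbedding {Y X : Type u} (H : Subgroup (Equiv.Perm Y)) (G : Subgroup (Equiv.Perm X))
    (Φ : Y ↪ X) : Prop :=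
  (∀ h ∈ H, ∃ g ∈ G, ∀ y, g (Φ y) = Φ (h y)) ∧
  (∀ g ∈ G, g '' Set.range Φ = Set.range Φ → ∃ h ∈ H, ∀ y, g (Φ y) = Φ (h y))

/-- A graph of group actions.  The actions at the arcs are indexed by edges, because the actions at
`a` and at `rev a` are the same. -/
structure GraphOfGroupActions : Type (u + 1) where
  Δ : SerreGraph.{u}
  connected : Δ.IsConnected
  X : Δ.V → Type u
  X_nonempty : ∀ v, Nonempty (X v)
  G : ∀ v, Subgroup (Equiv.Perm (X v))
  Y : Δ.Edge → Type u
  Y_nonempty : ∀ e, Nonempty (Y e)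
  H : ∀ e, Subgroup (Equiv.Perm (Y e))
  Φ : ∀ a : Δ.A, Y (Δ.edge a) ↪ X (Δ.t a)
  Φ_embedding : ∀ a, IsActionEmbedding (H (Δ.edge a)) (G (Δ.t a)) (Φ a)
  /-- The inversion agent of a self-reverse arc. -/
  agent : ∀ a : Δ.A, Δ.rev a = a → Equiv.Perm (Y (Δ.edge a))
  agent_normalizes : ∀ a ha k,
    k ∈ H (Δ.edge a) ↔ agent a ha * k * (agent a ha)⁻¹ ∈ H (Δ.edge a)
  agent_sq : ∀ a ha, agent a ha ^ 2 ∈ H (Δ.edge a)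

namespace GraphOfGroupActions

/-- Free: every arc action is the trivial group acting on a one-point set. -/
def IsFree (𝒢 : GraphOfGroupActions.{u}) : Prop :=
  ∀ a : 𝒢.Δ.A, Nonempty (Unique (𝒢.Y (𝒢.Δ.edge a))) ∧ 𝒢.H (𝒢.Δ.edge a) = ⊥

/-- `a`-adhesion sets: translates of `Φ_a(Y(a))`. -/
def IsAdhesionSet (𝒢 : GraphOfGroupActions.{u}) (a : 𝒢.Δ.A) (S : Set (𝒢.X (𝒢.Δ.t a))) : Prop :=
  ∃ γ ∈ 𝒢.G (𝒢.Δ.t a), S = γ '' Set.range (𝒢.Φ a)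

/-- `a`-adhesion maps `Ψ = γ Φ_a`. -/
def IsAdhesionMap (𝒢 : GraphOfGroupActions.{u}) (a : 𝒢.Δ.A)
    (Ψ : 𝒢.Y (𝒢.Δ.edge a) → 𝒢.X (𝒢.Δ.t a)) : Prop :=
  ∃ γ ∈ 𝒢.G (𝒢.Δ.t a), ∀ y, Ψ y = γ (𝒢.Φ a y)

/-- Twisted `a`-adhesion maps `Ψ = γ Φ_a h_a`, for a self-reverse arc `a`. -/
def IsTwistedAdhesionMap (𝒢 : GraphOfGroupActions.{u}) (a : 𝒢.Δ.A)
    (Ψ : 𝒢.Y (𝒢.Δ.edge a) → 𝒢.X (𝒢.Δ.t a)) : Prop :=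
  ∃ ha : 𝒢.Δ.rev a = a, ∃ γ ∈ 𝒢.G (𝒢.Δ.t a), ∀ y, Ψ y = γ (𝒢.Φ a (𝒢.agent a ha y))

/-- A scaffolding for a graph of group actions: a graph `graph` with an equivalence relation `r` on
its vertices whose quotient graph is a tree, a graph morphism `π` from that tree to the base
graph, and a legal colouring `pV`, `pA` of the vertices and arcs. -/
structure Scaffolding (𝒢 : GraphOfGroupActions.{u}) where
  graph : SerreGraph.{u}
  r : Setoid graph.V
  isTree : (graph.quot r).IsTree
  bundle_empty : ∀ a, ¬ r (graph.o a) (graph.t a)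
  π : (graph.quot r).Hom 𝒢.Δ
  pV : graph.V → Σ i : 𝒢.Δ.V, 𝒢.X i
  pA : graph.A → Σ e : 𝒢.Δ.Edge, 𝒢.Y e
  pV_bij : ∀ v : (graph.quot r).V,
    Set.BijOn pV {x | graph.clsV r x = v} {z | z.1 = π.onV v}
  pA_bij : ∀ α : (graph.quot r).A,
    Set.BijOn pA {b | graph.clsA r b = α} {z | z.1 = 𝒢.Δ.edge (π.onA α)}
  pA_rev : ∀ b, pA (graph.rev b) = pA b
  /-- The map determined by `Ψ_α (p b) = p (t b)` for the arcs `b` of the arc bundle `α`. -/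
  Ψ : ∀ α : (graph.quot r).A, 𝒢.Y (𝒢.Δ.edge (π.onA α)) → 𝒢.X (𝒢.Δ.t (π.onA α))
  Ψ_spec : ∀ (α : (graph.quot r).A) (b : graph.A) (y : 𝒢.Y (𝒢.Δ.edge (π.onA α))),
    graph.clsA r b = α → pA b = ⟨_, y⟩ → pV (graph.t b) = ⟨_, Ψ α y⟩
  adhesion : ∀ α, 𝒢.Δ.rev (π.onA α) ≠ π.onA α → 𝒢.IsAdhesionMap (π.onA α) (Ψ α)
  adhesion_selfReverse : ∀ α, 𝒢.Δ.rev (π.onA α) = π.onA α →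
    (𝒢.IsAdhesionMap (π.onA α) (Ψ α) ∧
      𝒢.IsTwistedAdhesionMap (π.onA ((graph.quot r).rev α)) (Ψ ((graph.quot r).rev α))) ∨
    (𝒢.IsTwistedAdhesionMap (π.onA α) (Ψ α) ∧
      𝒢.IsAdhesionMap (π.onA ((graph.quot r).rev α)) (Ψ ((graph.quot r).rev α)))
  /-- Each `b`-adhesion set at `v` comes from exactly one arc of the tree over `b` ending in `v`. -/
  adhesion_unique : ∀ (v : (graph.quot r).V) (b : 𝒢.Δ.A), 𝒢.Δ.t b = π.onV v →
    ∀ S : Set (𝒢.X (𝒢.Δ.t b)), 𝒢.IsAdhesionSet b S →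
      ∃! α : (graph.quot r).A, π.onA α = b ∧ (graph.quot r).t α = v ∧
        Sigma.mk (𝒢.Δ.t (π.onA α)) '' Set.range (Ψ α) = Sigma.mk (𝒢.Δ.t b) '' S

namespace Scaffolding

variable {𝒢 : GraphOfGroupActions.{u}} (S : 𝒢.Scaffolding)

/-- The tree of a scaffolding, that is, the tree associated with the graph of group actions. -/
abbrev tree : SerreGraph.{u} := S.graph.quot S.r

/-- The universal group: the automorphisms `g` of the scaffolding graph which preserve the
equivalence relation and the map `π`, and whose local action at each vertex bundle `[v]` (the
permutation `γ` of `X(π[v])` with `p g = γ p` on `[v]`) lies in `G(π[v])`. -/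
def universalGroup : Subgroup S.graph.Aut where
  carrier := {g | (∀ x y, S.r x y ↔ S.r (g.onV x) (g.onV y)) ∧
    (∀ x, S.π.onV (S.graph.clsV S.r (g.onV x)) = S.π.onV (S.graph.clsV S.r x)) ∧
    (∀ a, S.π.onA (S.graph.clsA S.r (g.onA a)) = S.π.onA (S.graph.clsA S.r a)) ∧
    ∀ (v : S.graph.V) (i : 𝒢.Δ.V), S.π.onV (S.graph.clsV S.r v) = i →
      ∃ γ ∈ 𝒢.G i, ∀ (x : S.graph.V) (z : 𝒢.X i), S.r v x → S.pV x = ⟨i, z⟩ →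
        S.pV (g.onV x) = ⟨i, γ z⟩}
  one_mem' := ⟨fun _ _ => Iff.rfl, fun _ => rfl, fun _ => rfl,
    fun _ i _ => ⟨1, (𝒢.G i).one_mem, fun _ _ _ h => h⟩⟩
  mul_mem' := by
    rintro g h ⟨g0, g1, g2, g3⟩ ⟨h0, h1, h2, h3⟩
    refine ⟨fun x y => by rw [h0, g0]; rfl, fun v => by simp [g1, h1], fun a => by simp [g2, h2],
      fun v i hv => ?_⟩
    obtain ⟨γ, hγ, hγ'⟩ := h3 v i hv
    obtain ⟨δ, hδ, hδ'⟩ := g3 (h.onV v) i (by rw [h1, hv])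
    exact ⟨δ * γ, (𝒢.G i).mul_mem hδ hγ, fun x z hx hz =>
      hδ' _ _ ((h0 v x).1 hx) (hγ' x z hx hz)⟩
  inv_mem' := by
    rintro g ⟨g0, g1, g2, g3⟩
    have k0 : ∀ x y, S.r x y ↔ S.r (g⁻¹.onV x) (g⁻¹.onV y) := fun x y => by
      rw [g0 (g⁻¹.onV x), SerreGraph.onV_inv, SerreGraph.onV_inv]
    have k1 : ∀ x, S.π.onV (S.graph.clsV S.r (g⁻¹.onV x)) = S.π.onV (S.graph.clsV S.r x) :=
      fun x => by rw [← g1 (g⁻¹.onV x), SerreGraph.onV_inv]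
    have k2 : ∀ a, S.π.onA (S.graph.clsA S.r (g⁻¹.onA a)) = S.π.onA (S.graph.clsA S.r a) :=
      fun a => by rw [← g2 (g⁻¹.onA a), SerreGraph.onA_inv]
    refine ⟨k0, k1, k2, fun v i hv => ?_⟩
    obtain ⟨γ, hγ, hγ'⟩ := g3 (g⁻¹.onV v) i (by rw [k1, hv])
    refine ⟨γ⁻¹, (𝒢.G i).inv_mem hγ, fun x z hx hz => ?_⟩
    have hr : S.r (g⁻¹.onV v) (g⁻¹.onV x) := (k0 v x).1 hx
    have hfst : (S.pV (g⁻¹.onV x)).1 = i := by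
      have h := (S.pV_bij (S.graph.clsV S.r (g⁻¹.onV x))).1 (x := g⁻¹.onV x) rfl
      have hx' : S.graph.clsV S.r v = S.graph.clsV S.r x := Quotient.sound hx
      rw [show (S.pV (g⁻¹.onV x)).1 = _ from h, k1, ← hx', hv]
    obtain ⟨j, y, hy⟩ : ∃ j y, S.pV (g⁻¹.onV x) = ⟨j, y⟩ := ⟨_, _, rfl⟩
    rw [hy] at hfst
    obtain rfl : j = i := hfst
    have h := hγ' _ y hr hy
    rw [SerreGraph.onV_inv, hz] at h
    simp only [Sigma.mk.injEq, heq_eq_eq, true_and] at h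
    rw [hy, h]
    exact congrArg (Sigma.mk j) (γ.symm_apply_apply y).symm

/-- The action of the universal group on the associated tree. -/
def treeAction : S.universalGroup →* S.tree.Aut where
  toFun g := S.graph.quotAut S.r g.1 g.2.1
  map_one' := by
    apply SerreGraph.Iso.ext <;> ext ⟨x⟩ <;> rfl
  map_mul' g h := by
    apply SerreGraph.Iso.ext <;> ext ⟨x⟩ <;> rfl

end Scaffolding

end GraphOfGroupActions

/-! In a free graph of group actions each arc bundle of a scaffolding is a single arc, and its
adhesion map picks out one point of `X(t a)`, lying in the `G(t a)`-orbit of `Φ_a(pt)`. These orbits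
are the arc sets of a local action diagram, and the adhesion point of a tree arc is its label. The
adhesion axiom (each adhesion set occurs exactly once at each vertex) then says exactly that labels
are bijective at each vertex.

From 3 to 1, the scaffolding's tree with these labels is a tree of that diagram. `range_treeAction`
shows that the automorphisms induced by the universal group are exactly the diagram's universal
group: local permutations of the orbits come from elements of `G(v)`, and prescribing these on
vertex colours lifts a tree automorphism to the scaffolding.

From 1 to 2, each `X(v)` receives one extra fixed point, and each tree vertex is blown up into a
centre and one vertex per incoming arc, coloured by the label of that arc. The fixed point keeps
centres apart from arc vertices, so the two universal groups coincide
(`universalGroupHom_bijective`).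

From 2 to 3, faithfulness of the given action makes the universal group act faithfully on the tree,
so it is isomorphic to its image. -/

namespace GraphOfGroupActions

/-! ### Local action diagrams from orbits of adhesion points -/

variable (𝒢 : GraphOfGroupActions.{u})

theorem IsFree.subsingleton {𝒢 : GraphOfGroupActions.{u}} (h𝒢 : 𝒢.IsFree) (a : 𝒢.Δ.A) :
    Subsingleton (𝒢.Y (𝒢.Δ.edge a)) := by
  obtain ⟨⟨hu⟩, _⟩ := h𝒢 a
  infer_instance

/-- A point of `Y(a)`. -/
noncomputable def basepoint (a : 𝒢.Δ.A) : 𝒢.Y (𝒢.Δ.edge a) :=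
  Classical.choice (𝒢.Y_nonempty _)

/-- The orbit of the image of the base point of `Y(a)` under `G(t a)`. -/
abbrev arcOrbit (a : 𝒢.Δ.A) : Set (𝒢.X (𝒢.Δ.t a)) :=
  MulAction.orbit (𝒢.G (𝒢.Δ.t a)) (𝒢.Φ a (𝒢.basepoint a))

/-- The disjoint union of the orbits at the arcs with terminus `v`. -/
abbrev OrbitSum (v : 𝒢.Δ.V) : Type u :=
  Σ a : {a : 𝒢.Δ.A // 𝒢.Δ.t a = v}, 𝒢.arcOrbit a.1

namespace OrbitSum

variable {𝒢} {v : 𝒢.Δ.V}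

/-- The underlying point of `X(v)`. -/
def val (z : 𝒢.OrbitSum v) : 𝒢.X v := z.1.2 ▸ z.2.1

theorem ext' {z z' : 𝒢.OrbitSum v} (h : z.1 = z'.1) (h' : z.val = z'.val) : z = z' := by
  obtain ⟨⟨a, rfl⟩, x⟩ := z
  obtain ⟨⟨b, hb⟩, y⟩ := z'
  obtain rfl : a = b := congrArg Subtype.val h
  exact congrArg _ (Subtype.ext h')

/-- `G(v)` acts on each of the orbits. -/
noncomputable def act (γ : 𝒢.G v) (z : 𝒢.OrbitSum v) : 𝒢.OrbitSum v :=
  ⟨z.1, (z.1.2.symm ▸ γ : 𝒢.G (𝒢.Δ.t z.1)) • z.2⟩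

theorem val_act (γ : 𝒢.G v) (z : 𝒢.OrbitSum v) : (act γ z).val = γ.1 z.val := by
  obtain ⟨⟨a, rfl⟩, x⟩ := z
  rfl

noncomputable instance : MulAction (𝒢.G v) (𝒢.OrbitSum v) where
  smul := act
  one_smul z := ext' rfl (val_act _ _)
  mul_smul γ δ z := ext' rfl (by
    change (act (γ * δ) z).val = (act γ (act δ z)).val
    rw [val_act, val_act, val_act]; rfl)

end OrbitSum

/-- The local action diagram of the orbits of the adhesion points. -/
noncomputable def toLocalActionDiagram : LocalActionDiagram.{u} where
  Γ := 𝒢.Δ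
  connected := 𝒢.connected
  -- Distinct arcs may have the same orbit in `X(v)`, hence a separate copy for each arc; points of
  -- `X(v)` outside these orbits are dropped.
  X a := 𝒢.arcOrbit a
  -- `G(v)` need not act faithfully on the remaining points, so only its image is kept.
  G v := (MulAction.toPermHom (𝒢.G v) (𝒢.OrbitSum v)).range
  orbit := by
    rintro v ⟨a, rfl⟩
    refine ⟨⟨⟨a, rfl⟩, ⟨_, MulAction.mem_orbit_self _⟩⟩, ?_⟩
    ext ⟨⟨b, hb⟩, x⟩
    constructor
    · rintro ⟨⟨_, γ, rfl⟩, h⟩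
      rw [← h]
      rfl
    · intro h
      obtain rfl : b = a := congrArg Subtype.val h
      obtain ⟨_, γ, rfl⟩ := x
      exact ⟨⟨_, γ, rfl⟩, rfl⟩

theorem toLocalActionDiagram_incl_eq {v : 𝒢.Δ.V} {a : 𝒢.Δ.A} {x : 𝒢.arcOrbit a}
    {z : 𝒢.OrbitSum v} :
    (⟨a, x⟩ : Σ a, 𝒢.arcOrbit a) = 𝒢.toLocalActionDiagram.incl (v := v) z ↔
      a = z.1.1 ∧ (⟨𝒢.Δ.t a, x.1⟩ : Σ i, 𝒢.X i) = ⟨v, z.val⟩ := by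
  obtain ⟨⟨b, rfl⟩, y⟩ := z
  constructor
  · intro h
    cases h
    exact ⟨rfl, rfl⟩
  · rintro ⟨h, h'⟩
    obtain rfl : a = b := h
    have : x = y := Subtype.ext (eq_of_heq (Sigma.mk.inj h').2)
    subst this
    rfl

/-! ### The labelled tree of a free scaffolding -/

namespace Scaffolding

variable {𝒢} (S : 𝒢.Scaffolding)

theorem exists_isAdhesionSet_arc (v : S.tree.V) (a : 𝒢.Δ.A) (ha : 𝒢.Δ.t a = S.π.onV v)
    (γ : 𝒢.G (𝒢.Δ.t a)) :
    ∃ α : S.tree.A, S.π.onA α = a ∧ S.tree.t α = v ∧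
        Sigma.mk (𝒢.Δ.t (S.π.onA α)) '' Set.range (S.Ψ α) =
          Sigma.mk (𝒢.Δ.t a) '' (γ.1 '' Set.range (𝒢.Φ a)) :=
  (S.adhesion_unique v a ha _ ⟨γ.1, γ.2, rfl⟩).exists

/-- Walks in the connected base graph lift: the adhesion axiom provides an arc over any base arc
ending at the current vertex. It controls incoming arcs only, so each step of the walk is reversed
before it is lifted. -/
theorem π_surjV : Function.Surjective S.π.onV := by
  obtain ⟨v₀⟩ := S.isTree.2.connected.nonempty
  intro j
  obtain ⟨p⟩ := 𝒢.connected.preconnected (S.π.onV v₀) j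
  suffices h : ∀ {i j} (p : 𝒢.Δ.toSimple.Walk i j), (∃ v, S.π.onV v = i) → ∃ v, S.π.onV v = j from
    h p ⟨_, rfl⟩
  intro i j p
  induction p with
  | nil => exact id
  | cons h p ih =>
    rintro ⟨v, rfl⟩
    obtain ⟨-, a, ha, rfl⟩ := h
    apply ih
    obtain ⟨α, h1, h2, -⟩ := S.exists_isAdhesionSet_arc v (𝒢.Δ.rev a) (by rw [← 𝒢.Δ.o_eq, ha]) 1
    exact ⟨S.tree.o α, by rw [S.π.map_o, h1, ← 𝒢.Δ.t_eq]⟩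

theorem π_surjA : Function.Surjective S.π.onA := by
  intro a
  obtain ⟨v, hv⟩ := S.π_surjV (𝒢.Δ.t a)
  obtain ⟨α, h, -⟩ := S.exists_isAdhesionSet_arc v a hv.symm 1
  exact ⟨α, h⟩

/-- An inversion agent permutes a one-point set, so twisting has no effect and the self-reverse case
merges with the other. -/
theorem exists_isAdhesionMap (h𝒢 : 𝒢.IsFree) (α : S.tree.A) :
    𝒢.IsAdhesionMap (S.π.onA α) (S.Ψ α) := by
  have := h𝒢.subsingleton (S.π.onA α)
  by_cases h : 𝒢.Δ.rev (S.π.onA α) = S.π.onA α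
  · obtain ⟨h, -⟩ | ⟨⟨_, γ, hγ, h⟩, -⟩ := S.adhesion_selfReverse α h
    · exact h
    · exact ⟨γ, hγ, fun y => by rw [h]; congr 2; exact Subsingleton.elim _ _⟩
  · exact S.adhesion α h

/-- The image of `Ψ_α`, a single point in the free case. -/
noncomputable def headPoint (h𝒢 : 𝒢.IsFree) (α : S.tree.A) : 𝒢.arcOrbit (S.π.onA α) :=
  ⟨S.Ψ α (𝒢.basepoint _), by
    obtain ⟨γ, hγ, h⟩ := S.exists_isAdhesionMap h𝒢 α
    exact ⟨⟨γ, hγ⟩, (h _).symm⟩⟩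

theorem range_Ψ (h𝒢 : 𝒢.IsFree) (α : S.tree.A) :
    Set.range (S.Ψ α) = {(S.headPoint h𝒢 α).1} := by
  have := h𝒢.subsingleton (S.π.onA α)
  ext x
  constructor
  · rintro ⟨y, rfl⟩
    exact congrArg (S.Ψ α) (Subsingleton.elim _ _)
  · rintro rfl
    exact ⟨_, rfl⟩

theorem pA_eq (h𝒢 : 𝒢.IsFree) (b : S.graph.A) :
    S.pA b = ⟨𝒢.Δ.edge (S.π.onA (S.graph.clsA S.r b)), 𝒢.basepoint _⟩ := by
  have := h𝒢.subsingleton (S.π.onA (S.graph.clsA S.r b))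
  have h : (S.pA b).1 = _ := (S.pA_bij (S.graph.clsA S.r b)).1 (x := b) rfl
  generalize S.pA b = q at h
  obtain ⟨e, y⟩ := q
  dsimp only at h
  subst h
  exact congrArg _ (Subsingleton.elim _ _)

theorem pV_t (h𝒢 : 𝒢.IsFree) (b : S.graph.A) :
    S.pV (S.graph.t b) = ⟨_, (S.headPoint h𝒢 (S.graph.clsA S.r b)).1⟩ :=
  S.Ψ_spec _ b _ rfl (S.pA_eq h𝒢 b)

/-- The colouring is injective on an arc bundle and takes values in a one-point set there. Hence the
arcs of the scaffolding are the arcs of its tree. -/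
theorem clsA_injective (h𝒢 : 𝒢.IsFree) : Function.Injective (S.graph.clsA S.r) := by
  intro a b h
  refine (S.pA_bij (S.graph.clsA S.r b)).2.1 h rfl ?_
  rw [S.pA_eq h𝒢, S.pA_eq h𝒢, h]

/-- The tree of the scaffolding is a tree of the associated local action diagram. -/
noncomputable def toTree (h𝒢 : 𝒢.IsFree) : 𝒢.toLocalActionDiagram.Tree where
  T := S.tree
  isTree := S.isTree
  π := S.π
  surjV := S.π_surjV
  surjA := S.π_surjA
  L α := ⟨S.π.onA α, S.headPoint h𝒢 α⟩
  bij := by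
    intro v a ha
    refine ⟨fun α hα => hα.2, ?_, ?_⟩
    · rintro α ⟨hα, rfl⟩ β ⟨hβ, hβ'⟩ h
      -- Injectivity of labels is the uniqueness part of the adhesion axiom; surjectivity below is
      -- the existence part.
      obtain ⟨γ, hγ, hγ'⟩ := S.exists_isAdhesionMap h𝒢 α
      refine (S.adhesion_unique v (S.π.onA α) ha (Set.range (S.Ψ α)) ⟨γ, hγ, ?_⟩).unique
        ⟨rfl, hα, rfl⟩ ⟨hβ', hβ, ?_⟩
      · rw [← Set.range_comp]
        exact congrArg Set.range (funext hγ')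
      · rw [S.range_Ψ h𝒢, S.range_Ψ h𝒢, Set.image_singleton, Set.image_singleton]
        exact congrArg (fun x : Σ a, 𝒢.arcOrbit a =>
          ({⟨𝒢.Δ.t x.1, x.2.1⟩} : Set (Σ i, 𝒢.X i))) h.symm
    · rintro ⟨b, x⟩ hb
      obtain rfl : b = a := hb
      obtain ⟨_, γ, rfl⟩ := x
      obtain ⟨α, rfl, h2, h3⟩ := S.exists_isAdhesionSet_arc v b ha γ
      refine ⟨α, ⟨h2, rfl⟩, congrArg (Sigma.mk _) (Subtype.ext ?_)⟩
      rw [S.range_Ψ h𝒢] at h3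
      have h4 := Set.image_injective.2 sigma_mk_injective h3
      have h5 : γ.1 (𝒢.Φ _ (𝒢.basepoint _)) ∈ ({(S.headPoint h𝒢 α).1} : Set _) := by
        rw [h4]
        exact ⟨_, ⟨_, rfl⟩, rfl⟩
      exact h5.symm

/-- This translates between labels of tree arcs and colours of their termini, and so carries local
actions across in both directions. -/
theorem toTree_L_eq (h𝒢 : 𝒢.IsFree) {i : 𝒢.Δ.V} (b : S.graph.A) (z : 𝒢.OrbitSum i) :
    (S.toTree h𝒢).L (S.graph.clsA S.r b) = 𝒢.toLocalActionDiagram.incl (v := i) z ↔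
      S.π.onA (S.graph.clsA S.r b) = z.1.1 ∧ S.pV (S.graph.t b) = ⟨i, z.val⟩ := by
  rw [S.pV_t h𝒢]
  exact 𝒢.toLocalActionDiagram_incl_eq

theorem vertex_ext {x y : S.graph.V} (h : S.graph.clsV S.r x = S.graph.clsV S.r y)
    (h' : S.pV x = S.pV y) : x = y :=
  (S.pV_bij (S.graph.clsV S.r y)).2.1 h rfl h'

theorem exists_pV_eq {x : S.graph.V} {i : 𝒢.Δ.V} (hi : S.π.onV (S.graph.clsV S.r x) = i) :
    ∃ z : 𝒢.X i, S.pV x = ⟨i, z⟩ := by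
  have h : (S.pV x).1 = _ := (S.pV_bij (S.graph.clsV S.r x)).1 (x := x) rfl
  rw [hi] at h
  subst h
  exact ⟨_, rfl⟩

theorem exists_vertex (v : S.tree.V) (i : 𝒢.Δ.V) (hi : S.π.onV v = i) (z : 𝒢.X i) :
    ∃ x, S.graph.clsV S.r x = v ∧ S.pV x = ⟨i, z⟩ := by
  obtain ⟨x, hx, hx'⟩ := (S.pV_bij v).2.2 (show (⟨i, z⟩ : Σ i, 𝒢.X i) ∈ _ from hi.symm)
  exact ⟨x, hx, hx'⟩

/-! ### The automorphisms induced on the tree -/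

theorem treeAction_mem (h𝒢 : 𝒢.IsFree) (g : S.universalGroup) :
    S.treeAction g ∈ (S.toTree h𝒢).universalGroup := by
  obtain ⟨g, g0, g1, g2, g3⟩ := g
  refine ⟨?_, ?_, ?_⟩
  · rintro ⟨x⟩
    exact g1 x
  · rintro ⟨a⟩
    exact g2 a
  · rintro ⟨x⟩ i hi
    obtain ⟨γ, hγ, h⟩ := g3 x i hi
    refine ⟨_, ⟨⟨γ, hγ⟩, rfl⟩, ?_⟩
    rintro ⟨b⟩ z hb hz
    obtain ⟨h1, h2⟩ := (S.toTree_L_eq h𝒢 b z).1 hz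
    refine (S.toTree_L_eq h𝒢 (g.onA b) (OrbitSum.act ⟨γ, hγ⟩ z)).2 ⟨(g2 b).trans h1, ?_⟩
    rw [← g.map_t]
    exact (h _ _ (S.r.symm (Quotient.exact hb)) h2).trans
      (congrArg (Sigma.mk _) (OrbitSum.val_act (v := i) ⟨γ, hγ⟩ z).symm)

/-- Tree automorphisms in the universal group of the local action diagram lift to the
scaffolding. -/
theorem exists_lift (h𝒢 : 𝒢.IsFree) (g : S.tree.Aut)
    (hg : g ∈ (S.toTree h𝒢).universalGroup) : ∃ k : S.universalGroup, S.treeAction k = g := by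
  obtain ⟨g1, g2, g3⟩ := hg
  replace g1 : ∀ v, S.π.onV (g.onV v) = S.π.onV v := g1
  replace g2 : ∀ a, S.π.onA (g.onA a) = S.π.onA a := g2
  -- A local permutation in the diagram is induced by some element of `G(π v)`; it is read here on
  -- the colours of termini of arcs.
  have g3' : ∀ v : S.tree.V, ∃ γ ∈ 𝒢.G (S.π.onV v), ∀ a b : S.graph.A,
      S.tree.t (S.graph.clsA S.r a) = v → S.graph.clsA S.r b = g.onA (S.graph.clsA S.r a) →
      ∀ z, S.pV (S.graph.t a) = ⟨_, z⟩ → S.pV (S.graph.t b) = ⟨S.π.onV v, γ z⟩ := by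
    intro v
    obtain ⟨_, ⟨⟨γ, hγ⟩, rfl⟩, h⟩ := g3 v _ rfl
    refine ⟨γ, hγ, fun a b hv hb z hz => ?_⟩
    have ht : 𝒢.Δ.t (S.π.onA (S.graph.clsA S.r a)) = S.π.onV v := by rw [← S.π.map_t, hv]
    let y : 𝒢.OrbitSum (S.π.onV v) := ⟨⟨_, ht⟩, S.headPoint h𝒢 (S.graph.clsA S.r a)⟩
    have hy := h (S.graph.clsA S.r a) y hv rfl
    have hy' := ((S.toTree_L_eq h𝒢 a y).1 rfl).2
    rw [hz] at hy'
    obtain rfl : z = y.val := by simpa using hy'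
    change (S.toTree h𝒢).L (g.onA _) = _ at hy
    rw [← hb] at hy
    exact ((S.toTree_L_eq h𝒢 b (OrbitSum.act ⟨γ, hγ⟩ y)).1 hy).2.trans
      (congrArg (Sigma.mk _) (OrbitSum.val_act ⟨γ, hγ⟩ y))
  choose γ hγ hγ' using g3'
  -- The lift sends a vertex of colour `z` in the bundle `v` to the vertex of colour `γ v z` in the
  -- bundle `g v`. Vertices that are not termini of arcs follow the chosen `γ v`.
  have hf : ∀ x, ∃ y, S.graph.clsV S.r y = g.onV (S.graph.clsV S.r x) ∧
      ∃ z, S.pV x = ⟨_, z⟩ ∧ S.pV y = ⟨_, γ (S.graph.clsV S.r x) z⟩ := by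
    intro x
    obtain ⟨z, hz⟩ := S.exists_pV_eq (x := x) rfl
    obtain ⟨y, hy, hy'⟩ := S.exists_vertex (g.onV (S.graph.clsV S.r x)) _ (g1 _) (γ _ z)
    exact ⟨y, hy, z, hz, hy'⟩
  choose f hf hf' using hf
  have hfp : ∀ {x v z}, S.graph.clsV S.r x = v → S.pV x = ⟨_, z⟩ →
      S.pV (f x) = ⟨S.π.onV v, γ v z⟩ := by
    rintro x _ z rfl h
    obtain ⟨z', hz, hz'⟩ := hf' x
    rw [h] at hz
    obtain rfl : z = z' := by simpa using hz
    exact hz'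
  have f_bij : Function.Bijective f := by
    constructor
    · intro x y h
      have hc : S.graph.clsV S.r x = S.graph.clsV S.r y :=
        g.onV.injective (by rw [← hf, ← hf, h])
      obtain ⟨z, hz⟩ := S.exists_pV_eq (congrArg S.π.onV hc)
      obtain ⟨z', hz'⟩ := S.exists_pV_eq (x := y) rfl
      refine S.vertex_ext hc ?_
      have := hfp hc hz
      rw [h, hfp rfl hz'] at this
      obtain rfl : z' = z := by simpa using this
      rw [hz, hz']
    · intro y
      obtain ⟨v, hv⟩ := g.onV.surjective (S.graph.clsV S.r y)
      obtain ⟨z, hz⟩ := S.exists_pV_eq (x := y) (i := S.π.onV v) (by rw [← hv, g1])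
      obtain ⟨x, hx, hx'⟩ := S.exists_vertex v _ rfl ((γ v).symm z)
      refine ⟨x, S.vertex_ext (by rw [hf, hx, hv]) ?_⟩
      rw [hfp hx hx', hz, Equiv.apply_symm_apply]
  let c : S.graph.A ≃ S.tree.A :=
    Equiv.ofBijective (S.graph.clsA S.r) ⟨S.clsA_injective h𝒢, Quotient.mk_surjective⟩
  let e : S.graph.A ≃ S.graph.A := (c.trans g.onA).trans c.symm
  have he : ∀ a, S.graph.clsA S.r (e a) = g.onA (S.graph.clsA S.r a) := fun a =>
    c.apply_symm_apply _
  have e_t : ∀ a, f (S.graph.t a) = S.graph.t (e a) := by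
    intro a
    -- Both vertices lie in the same bundle, and the choice of `γ` makes their colours agree.
    refine S.vertex_ext ?_ ?_
    · exact (hf _).trans ((g.map_t (S.graph.clsA S.r a)).trans (congrArg S.tree.t (he a)).symm)
    · obtain ⟨z, hz⟩ := S.exists_pV_eq (x := S.graph.t a) rfl
      exact (hfp rfl hz).trans (hγ' _ a (e a) rfl (he a) z hz).symm
  have e_rev : ∀ a, e (S.graph.rev a) = S.graph.rev (e a) := fun a =>
    S.clsA_injective h𝒢 ((he _).trans
      ((g.map_rev (S.graph.clsA S.r a)).trans (congrArg S.tree.rev (he a)).symm))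
  let k : S.graph.Aut :=
    { onV := Equiv.ofBijective f f_bij
      onA := e
      map_o := fun a => by
        rw [S.graph.o_eq, S.graph.o_eq, ← e_rev]
        exact e_t _
      map_t := e_t
      map_rev := e_rev }
  refine ⟨⟨k, fun x y => ?_, fun x => ?_, fun a => ?_, ?_⟩, ?_⟩
  · have h : S.graph.clsV S.r x = S.graph.clsV S.r y ↔
        S.graph.clsV S.r (f x) = S.graph.clsV S.r (f y) := by
      rw [hf, hf, g.onV.injective.eq_iff]
    exact (Quotient.eq (r := S.r)).symm.trans (h.trans (Quotient.eq (r := S.r)))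
  · change S.π.onV (S.graph.clsV S.r (f x)) = _
    rw [hf, g1]
  · change S.π.onA (S.graph.clsA S.r (e a)) = _
    rw [he, g2]
  · rintro v _ rfl
    exact ⟨_, hγ _, fun x z hx hz => hfp (Quotient.sound (S.r.symm hx)) hz⟩
  · apply SerreGraph.Iso.ext
    · ext ⟨x⟩
      exact hf x
    · ext ⟨a⟩
      exact he a

/-- Only the image can be compared: `treeAction` may have a kernel, since `G(v)` may move points
outside the adhesion orbits. -/
theorem range_treeAction (h𝒢 : 𝒢.IsFree) :
    S.treeAction.range = (S.toTree h𝒢).universalGroup := by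
  apply le_antisymm
  · rintro _ ⟨g, rfl⟩
    exact S.treeAction_mem h𝒢 g
  · intro g hg
    exact S.exists_lift h𝒢 g hg

end Scaffolding

end GraphOfGroupActions

/-! ### Blow-ups of graphs and isomorphisms of actions -/

namespace SerreGraph

variable {Γ : SerreGraph.{u}} {Δ : SerreGraph.{u}}

/-- An isomorphism of graphs induces an isomorphism of the underlying simple graphs. -/
def Iso.toSimple (e : Γ.Iso Δ) : Γ.toSimple ≃g Δ.toSimple where
  toEquiv := e.onV
  map_rel_iff' := by
    intro x y
    refine and_congr e.onV.injective.ne_iff ⟨?_, ?_⟩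
    · rintro ⟨a, h1, h2⟩
      obtain ⟨a, rfl⟩ := e.onA.surjective a
      rw [← e.map_o] at h1
      rw [← e.map_t] at h2
      exact ⟨a, e.onV.injective h1, e.onV.injective h2⟩
    · rintro ⟨a, rfl, rfl⟩
      exact ⟨e.onA a, (e.map_o a).symm, (e.map_t a).symm⟩

theorem IsTree.of_iso (h : Γ.IsTree) (e : Γ.Iso Δ) : Δ.IsTree := by
  refine ⟨⟨fun a => ?_, fun a b hab => ?_⟩, e.toSimple.isTree_iff.1 h.2⟩
  · obtain ⟨a, rfl⟩ := e.onA.surjective a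
    rw [← e.map_o, ← e.map_t]
    exact e.onV.injective.ne (h.1.1 a)
  · obtain ⟨a, rfl⟩ := e.onA.surjective a
    obtain ⟨b, rfl⟩ := e.onA.surjective b
    simp only [← e.map_o, ← e.map_t, Prod.mk.injEq, e.onV.apply_eq_iff_eq] at hab
    exact congrArg _ (h.1.2 (Prod.ext hab.1 hab.2))

/-- The inverse of an isomorphism, as a morphism. -/
def Iso.symmHom (e : Γ.Iso Δ) : Δ.Hom Γ where
  onV := e.onV.symm
  onA := e.onA.symm
  map_o a := by rw [Equiv.symm_apply_eq, e.map_o, Equiv.apply_symm_apply]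
  map_t a := by rw [Equiv.symm_apply_eq, e.map_t, Equiv.apply_symm_apply]
  map_rev a := by rw [Equiv.symm_apply_eq, e.map_rev, Equiv.apply_symm_apply]

/-- Composition of morphisms. -/
def Hom.comp {Θ : SerreGraph.{v}} (f : Δ.Hom Θ) (g : Γ.Hom Δ) : Γ.Hom Θ where
  onV x := f.onV (g.onV x)
  onA a := f.onA (g.onA a)
  map_o a := by rw [g.map_o, f.map_o]
  map_t a := by rw [g.map_t, f.map_t]
  map_rev a := by rw [g.map_rev, f.map_rev]

variable (Γ) in
/-- The graph in which every vertex `v` is replaced by `v` itself together with one vertex for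
each arc with terminus `v`, which becomes the terminus of this arc. -/
def blowup : SerreGraph.{u} where
  V := Γ.V ⊕ Γ.A
  A := Γ.A
  o a := Sum.inr (Γ.rev a)
  t a := Sum.inr a
  rev := Γ.rev
  rev_rev := Γ.rev_rev
  o_eq _ := rfl

variable (Γ) in
/-- The vertex of `Γ` from which a vertex of the blow-up comes. -/
def blowupProj : Γ.blowup.V → Γ.V := Sum.elim id Γ.t

variable (Γ) in
/-- Two vertices of the blow-up are equivalent when they come from the same vertex. -/
def blowupSetoid : Setoid Γ.blowup.V := Setoid.ker Γ.blowupProj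

/-- A simple graph is the quotient of its blow-up. -/
noncomputable def blowupIso (h : Γ.IsSimple) : Γ.Iso (Γ.blowup.quot Γ.blowupSetoid) where
  onV := Equiv.ofBijective (fun v => Γ.blowup.clsV Γ.blowupSetoid (Sum.inl v)) <| by
    refine ⟨fun x y hxy => Quotient.exact (s := Γ.blowupSetoid) hxy, ?_⟩
    rintro ⟨x⟩
    exact ⟨Γ.blowupProj x, Quotient.sound (s := Γ.blowupSetoid) rfl⟩
  onA := Equiv.ofBijective (fun a => Γ.blowup.clsA Γ.blowupSetoid a) <| by
    -- Equivalent arcs of the blow-up are arcs of `Γ` with the same ends, and these are equal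
    -- because there are no parallel arcs.
    refine ⟨fun a b hab => h.2 ?_, Quotient.mk_surjective⟩
    have := Quotient.exact (s := Γ.blowup.arcSetoid Γ.blowupSetoid) hab
    refine Prod.ext ?_ this.2
    change Γ.o a = Γ.o b
    rw [Γ.o_eq, Γ.o_eq]
    exact this.1
  map_o a := Quotient.sound (s := Γ.blowupSetoid) (Γ.o_eq a)
  map_t a := Quotient.sound (s := Γ.blowupSetoid) rfl
  map_rev a := rfl

theorem blowupIso_symm_clsV (h : Γ.IsSimple) (x : Γ.blowup.V) :
    (blowupIso h).onV.symm (Γ.blowup.clsV Γ.blowupSetoid x) = Γ.blowupProj x := by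
  rw [Equiv.symm_apply_eq]
  exact Quotient.sound (s := Γ.blowupSetoid) rfl

theorem blowupIso_symm_clsA (h : Γ.IsSimple) (a : Γ.A) :
    (blowupIso h).onA.symm (Γ.blowup.clsA Γ.blowupSetoid a) = a := by
  rw [Equiv.symm_apply_eq]
  rfl

/-- The action of an automorphism on the blow-up. -/
def blowupAut (g : Γ.Aut) : Γ.blowup.Aut where
  onV := Equiv.sumCongr g.onV g.onA
  onA := g.onA
  map_o a := congrArg Sum.inr (g.map_rev a)
  map_t _ := rfl
  map_rev := g.map_rev

theorem blowupProj_blowupAut (g : Γ.Aut) (x : Γ.blowup.V) :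
    Γ.blowupProj ((blowupAut g).onV x) = g.onV (Γ.blowupProj x) := by
  obtain x | x := x
  · rfl
  · exact (g.map_t x).symm

/-- The intertwining carries faithfulness of `ρ` over to `σ`, so `σ` is an isomorphism onto its
image. -/
theorem ActionIso.rangeRestrict {G K : Type*} [Group G] [Group K] {S T : SerreGraph.{u}}
    {ρ : G →* S.Aut} {σ : K →* T.Aut} (hρ : Function.Injective ρ) (h : ActionIso ρ σ) :
    ActionIso ρ σ.range.subtype := by
  obtain ⟨φ, Φ, h1, h2⟩ := h
  have hσ : Function.Injective σ := by
    rw [injective_iff_map_eq_one]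
    intro k hk
    obtain ⟨g, rfl⟩ := φ.surjective k
    have : ρ g = 1 := by
      apply Iso.ext
      · ext x
        apply Φ.onV.injective
        rw [h1, hk]
        rfl
      · ext x
        apply Φ.onA.injective
        rw [h2, hk]
        rfl
    rw [hρ (this.trans (map_one ρ).symm), map_one]
  exact ⟨φ.trans (MonoidHom.ofInjective hσ), Φ, h1, h2⟩

theorem ActionIso.trans {G K K' : Type*} [Group G] [Group K] [Group K'] {S T T' : SerreGraph.{u}}
    {ρ : G →* S.Aut} {σ : K →* T.Aut} {τ : K' →* T'.Aut} (h : ActionIso ρ σ)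
    (h' : ActionIso σ τ) : ActionIso ρ τ := by
  obtain ⟨φ, Φ, h1, h2⟩ := h
  obtain ⟨φ', Φ', h1', h2'⟩ := h'
  refine ⟨φ.trans φ', ⟨Φ.onV.trans Φ'.onV, Φ.onA.trans Φ'.onA, ?_, ?_, ?_⟩, ?_, ?_⟩
  · simp [Φ.map_o, Φ'.map_o]
  · simp [Φ.map_t, Φ'.map_t]
  · simp [Φ.map_rev, Φ'.map_rev]
  · simp [h1, h1']
  · simp [h2, h2']

end SerreGraph

/-! ### Free graphs of group actions from local action diagrams -/

namespace LocalActionDiagram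

variable (D : LocalActionDiagram.{u})

theorem fst_apply {v : D.Γ.V} {γ : Equiv.Perm (D.XV v)} (hγ : γ ∈ D.G v) (z : D.XV v) :
    (γ z).1 = z.1 := by
  obtain ⟨x, hx⟩ := D.orbit v z.1
  have hz : z ∈ MulAction.orbit (D.G v) x := by
    rw [hx]
    rfl
  have : γ z ∈ MulAction.orbit (D.G v) x := by
    rw [← MulAction.orbit_eq_iff.2 hz]
    exact ⟨⟨γ, hγ⟩, rfl⟩
  rw [hx] at this
  exact this

theorem exists_apply_eq {v : D.Γ.V} (z z' : D.XV v) (h : z.1 = z'.1) :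
    ∃ γ ∈ D.G v, γ z = z' := by
  obtain ⟨x, hx⟩ := D.orbit v z.1
  have hz : z ∈ MulAction.orbit (D.G v) x := by
    rw [hx]
    rfl
  have hz' : z' ∈ MulAction.orbit (D.G v) x := by
    rw [hx]
    exact h.symm
  rw [← MulAction.orbit_eq_iff.2 hz] at hz'
  obtain ⟨γ, hγ⟩ := hz'
  exact ⟨γ.1, γ.2, hγ⟩

/-- An orbit contains its base point. This supplies the adhesion point of each arc. -/
theorem nonempty_fiber (a : D.Γ.A) : Nonempty (D.X a) := by
  obtain ⟨x, hx⟩ := D.orbit _ ⟨a, rfl⟩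
  have h : x.1 = _ := hx.subset (MulAction.mem_orbit_self x)
  obtain ⟨⟨b, hb⟩, y⟩ := x
  obtain rfl : b = a := congrArg Subtype.val h
  exact ⟨y⟩

/-- A point of `X(t a)` in the orbit `X(a)`. -/
noncomputable def basepoint (a : D.Γ.A) : D.XV (D.Γ.t a) :=
  ⟨⟨a, rfl⟩, Classical.choice (D.nonempty_fiber a)⟩

/-- Extension of permutations of `α` to `Option α` by a fixed point. -/
def optionHom (α : Type u) : Equiv.Perm α →* Equiv.Perm (Option α) where
  toFun := Equiv.optionCongr
  map_one' := Equiv.optionCongr_refl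
  map_mul' f g := Equiv.ext fun x => by cases x <;> rfl

/-- The free graph of group actions of a local action diagram.  Each local action gets an
additional fixed point, so that it is non-empty. -/
noncomputable def toGraphOfGroupActions : GraphOfGroupActions.{u} where
  Δ := D.Γ
  connected := D.connected
  X v := Option (D.XV v)
  X_nonempty _ := ⟨none⟩
  G v := (D.G v).map (optionHom _)
  Y _ := PUnit
  Y_nonempty _ := ⟨⟨⟩⟩
  H _ := ⊥
  Φ a := ⟨fun _ => some (D.basepoint a), fun _ _ _ => rfl⟩
  Φ_embedding a := by
    refine ⟨fun h _ => ⟨1, one_mem _, fun y => rfl⟩, fun g _ hg => ⟨1, one_mem _, fun y => ?_⟩⟩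
    -- A permutation that stabilises a one-point set fixes its point.
    obtain ⟨_, h⟩ := hg.subset ⟨_, ⟨y, rfl⟩, rfl⟩
    exact h.symm
  agent _ _ := 1
  agent_normalizes _ _ _ := by simp
  agent_sq _ _ := by simp

theorem toGraphOfGroupActions_isFree : D.toGraphOfGroupActions.IsFree :=
  fun _ => ⟨⟨inferInstanceAs (Unique PUnit)⟩, rfl⟩

theorem incl_injective (v : D.Γ.V) : Function.Injective (D.incl (v := v)) := by
  rintro ⟨⟨a, ha⟩, x⟩ ⟨⟨b, hb⟩, y⟩ hxy
  simp only [incl, Sigma.mk.injEq] at hxy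
  obtain ⟨rfl, hxy⟩ := hxy
  obtain rfl := eq_of_heq hxy
  rfl

/-! ### The blow-up of the tree as a scaffolding -/

namespace Tree

variable {D} (S : D.Tree)

theorem L_fst (b : S.T.A) : (S.L b).1 = S.π.onA b :=
  (S.bij (S.T.t b) (S.π.onA b) (S.π.map_t b).symm).1 ⟨rfl, rfl⟩

/-- The label of the arc `b`, as a point of `X(i)` where `i` is the image of its terminus. -/
def label (b : S.T.A) (i : D.Γ.V) (hi : S.π.onV (S.T.t b) = i) : D.XV i :=
  ⟨⟨(S.L b).1, by rw [S.L_fst, ← S.π.map_t, hi]⟩, (S.L b).2⟩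

theorem incl_label (b : S.T.A) (i : D.Γ.V) (hi : S.π.onV (S.T.t b) = i) :
    D.incl (S.label b i hi) = S.L b := rfl

theorem label_fst (b : S.T.A) (i : D.Γ.V) (hi : S.π.onV (S.T.t b) = i) :
    (S.label b i hi).1.1 = S.π.onA b := S.L_fst b

theorem exists_label_eq (v : S.T.V) (i : D.Γ.V) (hv : S.π.onV v = i) (z : D.XV i) :
    ∃ b, ∃ h : S.T.t b = v, S.label b i (h ▸ hv) = z := by
  obtain ⟨b, ⟨h1, h2⟩, h3⟩ := (S.bij v z.1.1 (z.1.2.trans hv.symm)).2.2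
    (show D.incl z ∈ _ from rfl)
  exact ⟨b, h1, D.incl_injective _ h3⟩

theorem label_injective {b c : S.T.A} {i : D.Γ.V} {hb : S.π.onV (S.T.t b) = i}
    {hc : S.π.onV (S.T.t c) = i} (ht : S.T.t b = S.T.t c)
    (h : S.label b i hb = S.label c i hc) : b = c := by
  have hL : S.L b = S.L c := congrArg D.incl h
  refine (S.bij (S.T.t b) (S.π.onA b) (S.π.map_t b).symm).2.1 ⟨rfl, rfl⟩ ⟨ht.symm, ?_⟩ hL
  rw [← L_fst, ← L_fst, hL]

/-- The colour of a vertex of the blow-up. -/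
def colour : S.T.blowup.V → Σ i : D.Γ.V, Option (D.XV i)
  | Sum.inl v => ⟨S.π.onV v, none⟩
  | Sum.inr b => ⟨S.π.onV (S.T.t b), some (S.label b _ rfl)⟩

theorem colour_inl {v : S.T.V} {i : D.Γ.V} (hi : S.π.onV v = i) :
    S.colour (Sum.inl v) = ⟨i, none⟩ := by
  subst hi
  rfl

theorem colour_inr {b : S.T.A} {i : D.Γ.V} (hi : S.π.onV (S.T.t b) = i) :
    S.colour (Sum.inr b) = ⟨i, some (S.label b i hi)⟩ := by
  subst hi
  rfl

theorem colour_fst (x : S.T.blowup.V) : (S.colour x).1 = S.π.onV (S.T.blowupProj x) := by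
  cases x <;> rfl

/-- Within one bundle the centre is the only vertex coloured `none`, and the other vertices are
separated by the labels of their arcs. -/
theorem colour_injective {x y : S.T.blowup.V} (h : S.T.blowupProj x = S.T.blowupProj y)
    (hc : S.colour x = S.colour y) : x = y := by
  obtain v | b := x <;> obtain w | c := y
  · exact congrArg Sum.inl h
  · replace h : v = S.T.t c := h
    rw [S.colour_inl rfl, S.colour_inr (i := S.π.onV v) (by rw [h])] at hc
    simp at hc
  · replace h : S.T.t b = w := h
    rw [S.colour_inl (v := w) rfl, S.colour_inr (i := S.π.onV w) (by rw [h])] at hc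
    simp at hc
  · replace h : S.T.t b = S.T.t c := h
    rw [S.colour_inr (b := c) rfl, S.colour_inr (i := S.π.onV (S.T.t c)) (by rw [h])] at hc
    exact congrArg Sum.inr (S.label_injective h (by simpa using hc))

theorem exists_colour_eq (v : S.T.V) (i : D.Γ.V) (hv : S.π.onV v = i) (z : Option (D.XV i)) :
    ∃ x, S.T.blowupProj x = v ∧ S.colour x = ⟨i, z⟩ := by
  obtain _ | z := z
  · exact ⟨Sum.inl v, rfl, S.colour_inl hv⟩
  · obtain ⟨b, hb, rfl⟩ := S.exists_label_eq v i hv z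
    exact ⟨Sum.inr b, hb, S.colour_inr _⟩

/-- The morphism from the quotient of the blow-up to the base graph. -/
noncomputable def blowupHom : (S.T.blowup.quot S.T.blowupSetoid).Hom D.Γ :=
  S.π.comp (SerreGraph.blowupIso S.isTree.1).symmHom

theorem blowupHom_clsV (x : S.T.blowup.V) :
    S.blowupHom.onV (S.T.blowup.clsV S.T.blowupSetoid x) = S.π.onV (S.T.blowupProj x) :=
  congrArg S.π.onV (SerreGraph.blowupIso_symm_clsV S.isTree.1 x)

theorem blowupHom_clsA (b : S.T.A) :
    S.blowupHom.onA (S.T.blowup.clsA S.T.blowupSetoid b) = S.π.onA b :=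
  congrArg S.π.onA (SerreGraph.blowupIso_symm_clsA S.isTree.1 b)

/-- The adhesion maps of the blow-up. -/
noncomputable def adhesionMap (α : (S.T.blowup.quot S.T.blowupSetoid).A) (_ : PUnit.{u + 1}) :
    Option (D.XV (D.Γ.t (S.blowupHom.onA α))) :=
  some (S.label ((SerreGraph.blowupIso S.isTree.1).onA.symm α) _ (S.π.map_t _))

theorem colour_inr_eq_adhesionMap (b : S.T.A) (y : PUnit) :
    S.colour (Sum.inr b) = ⟨_, S.adhesionMap (S.T.blowup.clsA S.T.blowupSetoid b) y⟩ := by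
  -- The type of `adhesionMap` depends on the class, so the class is made a variable before `b` is
  -- eliminated.
  obtain ⟨α, hα⟩ : ∃ α, S.T.blowup.clsA S.T.blowupSetoid b = α := ⟨_, rfl⟩
  have hb := SerreGraph.blowupIso_symm_clsA S.isTree.1 b
  rw [hα] at hb ⊢
  subst hb
  exact S.colour_inr _

theorem image_range_adhesionMap (b : S.T.A) :
    Sigma.mk (β := fun i => Option (D.XV i)) _ ''
        Set.range (S.adhesionMap (S.T.blowup.clsA S.T.blowupSetoid b)) =
      {S.colour (Sum.inr b)} := by
  rw [S.colour_inr_eq_adhesionMap b ⟨⟩, ← Set.image_singleton]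
  exact congrArg _ (Set.range_const (ι := PUnit.{u + 1}))

/-- The base point and the label both lie in `X(a)`, on which the local group is transitive. -/
theorem isAdhesionMap (α : (S.T.blowup.quot S.T.blowupSetoid).A) :
    D.toGraphOfGroupActions.IsAdhesionMap (S.blowupHom.onA α) (S.adhesionMap α) := by
  obtain ⟨γ, hγ, h⟩ := D.exists_apply_eq (D.basepoint (S.blowupHom.onA α))
    (S.label ((SerreGraph.blowupIso S.isTree.1).onA.symm α) _ (S.π.map_t _))
    (Subtype.ext (S.label_fst _ _ _).symm)
  exact ⟨_, ⟨γ, hγ, rfl⟩, fun _ => congrArg some h.symm⟩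

/-- An arc of the blow-up is determined by its terminus, so the claim reduces to the unique vertex
of a given colour in a bundle. That colour is not `none`, so the vertex is not the centre. -/
theorem existsUnique_arc (v : (S.T.blowup.quot S.T.blowupSetoid).V) (b : D.Γ.A)
    (hb : D.Γ.t b = S.blowupHom.onV v) (z : D.XV (D.Γ.t b)) (hz : z.1.1 = b) :
    ∃! α, S.blowupHom.onA α = b ∧ (S.T.blowup.quot S.T.blowupSetoid).t α = v ∧
      Sigma.mk (β := fun i => Option (D.XV i)) _ '' Set.range (S.adhesionMap α) =
        {⟨D.Γ.t b, some z⟩} := by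
  obtain ⟨x, rfl⟩ : ∃ x, S.T.blowup.clsV S.T.blowupSetoid x = v := Quotient.exists_rep v
  rw [S.blowupHom_clsV] at hb
  have key : ∀ c : S.T.A,
      (S.blowupHom.onA (S.T.blowup.clsA S.T.blowupSetoid c) = b ∧
        (S.T.blowup.quot S.T.blowupSetoid).t (S.T.blowup.clsA S.T.blowupSetoid c) =
          S.T.blowup.clsV S.T.blowupSetoid x ∧
        Sigma.mk (β := fun i => Option (D.XV i)) _ ''
            Set.range (S.adhesionMap (S.T.blowup.clsA S.T.blowupSetoid c)) =
          {⟨D.Γ.t b, some z⟩}) ↔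
      S.T.t c = S.T.blowupProj x ∧ S.colour (Sum.inr c) = ⟨D.Γ.t b, some z⟩ := by
    intro c
    have hc := S.image_range_adhesionMap c
    constructor
    · rintro ⟨-, h1, h2⟩
      exact ⟨Quotient.exact (s := S.T.blowupSetoid) h1,
        Set.singleton_injective (hc.symm.trans h2)⟩
    · rintro ⟨h1, h2⟩
      refine ⟨?_, Quotient.sound (s := S.T.blowupSetoid) h1, hc.trans (congrArg _ h2)⟩
      have hi : S.π.onV (S.T.t c) = D.Γ.t b := by rw [h1, hb]
      rw [S.colour_inr hi] at h2
      obtain rfl : S.label c _ hi = z := by simpa using h2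
      exact (S.blowupHom_clsA c).trans ((S.label_fst _ _ _).symm.trans hz)
  obtain ⟨w | c, h1, h2⟩ := S.exists_colour_eq _ _ hb.symm (some z)
  · cases eq_of_heq (Sigma.mk.inj
      ((S.colour_inl (i := D.Γ.t b) (hb.trans (congrArg _ h1.symm)).symm).symm.trans h2)).2
  · refine ⟨S.T.blowup.clsA S.T.blowupSetoid c, (key c).2 ⟨h1, h2⟩, ?_⟩
    rintro ⟨d⟩ hd
    obtain ⟨h3, h4⟩ := (key d).1 hd
    have : (Sum.inr d : S.T.blowup.V) = Sum.inr c :=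
      S.colour_injective (h3.trans h1.symm) (h4.trans h2.symm)
    rw [Sum.inr_injective this]
    rfl

/-- The blow-up of the tree is a scaffolding for the associated graph of group actions. -/
noncomputable def toScaffolding : D.toGraphOfGroupActions.Scaffolding where
  graph := S.T.blowup
  r := S.T.blowupSetoid
  isTree := S.isTree.of_iso (SerreGraph.blowupIso S.isTree.1)
  bundle_empty a h := S.isTree.1.1 a ((S.T.o_eq a).trans h)
  π := S.blowupHom
  pV := S.colour
  pA b := ⟨D.Γ.edge (S.π.onA b), ⟨⟩⟩
  pV_bij := by
    rintro ⟨x⟩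
    refine ⟨?_, ?_, ?_⟩
    · intro y hy
      exact (S.colour_fst y).trans
        ((S.blowupHom_clsV y).symm.trans (congrArg S.blowupHom.onV hy))
    · intro y hy z hz h
      exact S.colour_injective
        (Quotient.exact (s := S.T.blowupSetoid) (Eq.trans hy (Eq.symm hz))) h
    · rintro ⟨i, z⟩ hi
      obtain ⟨y, h1, h2⟩ := S.exists_colour_eq (S.T.blowupProj x) i
        (Eq.trans (S.blowupHom_clsV x).symm (Eq.symm hi)) z
      exact ⟨y, Quotient.sound (s := S.T.blowupSetoid) h1, h2⟩
  pA_bij := by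
    rintro ⟨a⟩
    refine ⟨?_, ?_, ?_⟩
    · intro b hb
      exact congrArg D.Γ.edge ((S.blowupHom_clsA b).symm.trans (congrArg _ hb))
    · intro b hb c hc _
      exact (SerreGraph.blowupIso S.isTree.1).onA.injective (Eq.trans hb (Eq.symm hc))
    · rintro ⟨e, y⟩ he
      refine ⟨a, rfl, ?_⟩
      obtain rfl : e = D.Γ.edge (S.π.onA a) :=
        Eq.trans he (congrArg D.Γ.edge (S.blowupHom_clsA a))
      rfl
  pA_rev b := by
    have key : ∀ b : S.T.A, D.Γ.edge (S.π.onA (S.T.rev b)) = D.Γ.edge (S.π.onA b) := fun b => by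
      rw [S.π.map_rev, D.Γ.edge_rev]
    exact congrArg (fun e => (⟨e, ⟨⟩⟩ : Σ _ : D.Γ.Edge, PUnit.{u + 1})) (key b)
  Ψ := S.adhesionMap
  Ψ_spec := by
    rintro _ b y rfl -
    exact S.colour_inr_eq_adhesionMap b y
  adhesion α _ := S.isAdhesionMap α
  adhesion_selfReverse α hα := by
    -- The agents are trivial, so an adhesion map is also a twisted one.
    refine Or.inl ⟨S.isAdhesionMap α, ?_, S.isAdhesionMap _⟩
    rw [S.blowupHom.map_rev]
    exact congrArg D.Γ.rev hα
  adhesion_unique := by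
    rintro v b hb _ ⟨_, ⟨γ, hγ, rfl⟩, rfl⟩
    have hA : Sigma.mk (β := fun i => Option (D.XV i)) (D.Γ.t b) ''
        (optionHom _ γ '' Set.range fun _ : PUnit.{u + 1} => some (D.basepoint b)) =
          {⟨D.Γ.t b, some (γ (D.basepoint b))⟩} := by
      rw [Set.range_const]
      exact (congrArg _ (Set.image_singleton ..)).trans (Set.image_singleton ..)
    -- Local permutations preserve each `X(a)`, so the translated base point still belongs to the
    -- arc `b`.
    have h := S.existsUnique_arc v b hb (γ (D.basepoint b))
      (congrArg Subtype.val (D.fst_apply hγ (D.basepoint b)))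
    rw [← hA] at h
    exact h

/-! ### Comparison of the two universal groups -/

theorem blowupAut_mem {g : S.T.Aut} (hg : g ∈ S.universalGroup) :
    SerreGraph.blowupAut g ∈ S.toScaffolding.universalGroup := by
  obtain ⟨g1, g2, g3⟩ := hg
  have hp : ∀ x, S.T.blowupProj ((SerreGraph.blowupAut g).onV x) = g.onV (S.T.blowupProj x) :=
    SerreGraph.blowupProj_blowupAut g
  refine ⟨fun x y => ?_, fun x => ?_, fun a => ?_, ?_⟩
  · change S.T.blowupProj x = S.T.blowupProj y ↔ S.T.blowupProj _ = S.T.blowupProj _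
    exact g.onV.apply_eq_iff_eq.symm.trans (Eq.congr (hp x) (hp y)).symm
  · refine (S.blowupHom_clsV _).trans (Eq.trans ?_ (S.blowupHom_clsV _).symm)
    exact (congrArg S.π.onV (hp x)).trans (g1 _)
  · exact (S.blowupHom_clsA _).trans ((g2 a).trans (S.blowupHom_clsA _).symm)
  · intro v i hi
    replace hi : S.π.onV (S.T.blowupProj v) = i := (S.blowupHom_clsV v).symm.trans hi
    obtain ⟨γ, hγ, h⟩ := g3 _ i hi
    refine ⟨_, ⟨γ, hγ, rfl⟩, fun x z hx hz => ?_⟩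
    replace hx : S.T.blowupProj v = S.T.blowupProj x := hx
    rw [hx] at hi h
    change S.colour x = _ at hz
    change S.colour _ = _
    obtain w | b := x
    · obtain rfl : none = z := eq_of_heq (Sigma.mk.inj ((S.colour_inl hi).symm.trans hz)).2
      exact S.colour_inl ((g1 w).trans hi)
    · obtain rfl : some _ = z := eq_of_heq (Sigma.mk.inj ((S.colour_inr hi).symm.trans hz)).2
      have hi' : S.π.onV (S.T.t (g.onA b)) = i := by rw [← g.map_t, g1]; exact hi
      refine (S.colour_inr hi').trans ?_
      rw [D.incl_injective i ((S.incl_label _ _ _).trans (h b (S.label b i hi) rfl rfl))]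
      rfl

/-- Local actions fix `none`, so centres go to centres. The induced map on centres, together with
the given map on arcs, is the required tree automorphism. -/
theorem exists_blowupAut_eq {h : S.T.blowup.Aut} (hh : h ∈ S.toScaffolding.universalGroup) :
    ∃ g ∈ S.universalGroup, SerreGraph.blowupAut g = h := by
  obtain ⟨h0, h1, h2, h3⟩ := hh
  replace h0 : ∀ x y, S.T.blowupProj x = S.T.blowupProj y ↔
    S.T.blowupProj (h.onV x) = S.T.blowupProj (h.onV y) := h0
  replace h1 : ∀ x, S.π.onV (S.T.blowupProj (h.onV x)) = S.π.onV (S.T.blowupProj x) := fun x =>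
    (S.blowupHom_clsV _).symm.trans ((h1 x).trans (S.blowupHom_clsV _))
  replace h2 : ∀ a, S.π.onA (h.onA a) = S.π.onA a := fun a =>
    (S.blowupHom_clsA _).symm.trans ((h2 a).trans (S.blowupHom_clsA _))
  replace h3 : ∀ (v : S.T.blowup.V) (i : D.Γ.V), S.π.onV (S.T.blowupProj v) = i →
      ∃ γ ∈ D.G i, ∀ x z, S.T.blowupProj v = S.T.blowupProj x → S.colour x = ⟨i, z⟩ →
        S.colour (h.onV x) = ⟨i, optionHom _ γ z⟩ := by
    intro v i hi
    obtain ⟨_, ⟨γ, hγ, rfl⟩, h⟩ := h3 v i ((S.blowupHom_clsV v).trans hi)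
    exact ⟨γ, hγ, h⟩
  have hr : ∀ b : S.T.A, h.onV (Sum.inr b) = Sum.inr (h.onA b) := h.map_t
  have hl : ∀ v, ∃ w, h.onV (Sum.inl v) = Sum.inl w := by
    intro v
    obtain ⟨γ, -, hγ⟩ := h3 (Sum.inl v) _ rfl
    have := hγ (Sum.inl v) none rfl (S.colour_inl rfl)
    obtain ⟨y, hy⟩ : ∃ y, h.onV (Sum.inl v) = y := ⟨_, rfl⟩
    have hi := h1 (Sum.inl v)
    rw [hy] at this hi ⊢
    obtain w | b := y
    · exact ⟨w, rfl⟩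
    · rw [S.colour_inr hi] at this
      cases eq_of_heq (Sigma.mk.inj this).2
  choose f hf using hl
  have f_bij : Function.Bijective f := by
    refine ⟨fun v w hvw => ?_, fun w => ?_⟩
    · exact Sum.inl_injective (h.onV.injective (by rw [hf, hf, hvw]))
    · obtain ⟨v | b, hv⟩ := h.onV.surjective (Sum.inl w)
      · exact ⟨v, Sum.inl_injective ((hf v).symm.trans hv)⟩
      · rw [hr] at hv
        cases hv
  have f_t : ∀ a, f (S.T.t a) = S.T.t (h.onA a) := by
    intro a
    -- The vertex of the arc `a` lies in the bundle of the centre `t a`, and bundles are preserved.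
    have := (h0 (Sum.inl (S.T.t a)) (Sum.inr a)).1 rfl
    rw [hf, hr] at this
    exact this
  let g : S.T.Aut :=
    { onV := Equiv.ofBijective f f_bij
      onA := h.onA
      map_o := fun a => by
        rw [S.T.o_eq, S.T.o_eq]
        exact (f_t _).trans (congrArg S.T.t (h.map_rev a))
      map_t := f_t
      map_rev := h.map_rev }
  refine ⟨g, ⟨fun v => ?_, h2, fun v i hi => ?_⟩, ?_⟩
  · have := h1 (Sum.inl v)
    rw [hf] at this
    exact this
  · obtain ⟨γ, hγ, h4⟩ := h3 (Sum.inl v) i hi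
    refine ⟨γ, hγ, ?_⟩
    rintro b x rfl hx
    have h5 := h4 (Sum.inr b) (some x) rfl (by
      rw [S.colour_inr hi, D.incl_injective i ((S.incl_label b i hi).trans hx)])
    have hi' : S.π.onV (S.T.t (h.onA b)) = i := by
      have := h1 (Sum.inr b)
      rw [hr] at this
      exact this.trans hi
    rw [hr] at h5
    have h6 : some _ = some (γ x) := eq_of_heq (Sigma.mk.inj ((S.colour_inr hi').symm.trans h5)).2
    rw [← Option.some_injective _ h6]
    rfl
  · apply SerreGraph.Iso.ext
    · ext (v | b)
      · exact (hf v).symm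
      · exact (hr b).symm
    · rfl

/-- The universal group of the tree acts on the blow-up. -/
noncomputable def universalGroupHom : S.universalGroup →* S.toScaffolding.universalGroup where
  toFun g := ⟨SerreGraph.blowupAut g.1, S.blowupAut_mem g.2⟩
  map_one' := Subtype.ext (SerreGraph.Iso.ext (by ext (x | x) <;> rfl) rfl)
  map_mul' g h := Subtype.ext (SerreGraph.Iso.ext (by ext (x | x) <;> rfl) rfl)

theorem universalGroupHom_bijective : Function.Bijective S.universalGroupHom := by
  constructor
  · intro g g' h
    have h' : SerreGraph.blowupAut g.1 = SerreGraph.blowupAut g'.1 := congrArg Subtype.val h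
    apply Subtype.ext
    apply SerreGraph.Iso.ext
    · ext v
      exact Sum.inl_injective (congrArg (fun k : S.T.blowup.Aut => k.onV (Sum.inl v)) h')
    · exact congrArg (fun k : S.T.blowup.Aut => k.onA) h'
  · rintro ⟨h, hh⟩
    obtain ⟨g, hg, rfl⟩ := S.exists_blowupAut_eq hh
    exact ⟨⟨g, hg⟩, rfl⟩

theorem actionIso_treeAction :
    SerreGraph.ActionIso S.universalGroup.subtype S.toScaffolding.treeAction :=
  ⟨MulEquiv.ofBijective _ S.universalGroupHom_bijective, SerreGraph.blowupIso S.isTree.1,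
    fun _ _ => rfl, fun _ _ => rfl⟩

end Tree

end LocalActionDiagram

/-! ### The equivalences -/

theorem GraphOfGroupActions.Scaffolding.actionIso_toTree {G : Type w} [Group G]
    {T : SerreGraph.{u}} {ρ : G →* T.Aut} {𝒢 : GraphOfGroupActions.{u}} (h𝒢 : 𝒢.IsFree)
    (S : 𝒢.Scaffolding) (h : SerreGraph.ActionIso ρ S.treeAction.range.subtype) :
    SerreGraph.ActionIso ρ (S.toTree h𝒢).universalGroup.subtype := by
  -- The tree of `S.toTree h𝒢` is `S.tree` only after unfolding, so the equality of subgroups is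
  -- eliminated for a variable `K`.
  have key : ∀ K : Subgroup S.tree.Aut, S.treeAction.range = K →
      SerreGraph.ActionIso ρ K.subtype := by
    rintro _ rfl
    exact h
  exact key _ (S.range_treeAction h𝒢)

theorem mainTheorem10 {G : Type w} [Group G] (T : SerreGraph.{u}) (hT : T.IsTree)
    (ρ : G →* T.Aut) (hρ : Function.Injective ρ) :
    ((∃ (D : LocalActionDiagram.{u}) (S : D.Tree),
        SerreGraph.ActionIso ρ S.universalGroup.subtype) ↔
      ∃ (𝒢 : GraphOfGroupActions.{u}) (_ : 𝒢.IsFree) (S : 𝒢.Scaffolding),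
        SerreGraph.ActionIso ρ S.treeAction) ∧
    ((∃ (D : LocalActionDiagram.{u}) (S : D.Tree),
        SerreGraph.ActionIso ρ S.universalGroup.subtype) ↔
      ∃ (𝒢 : GraphOfGroupActions.{u}) (_ : 𝒢.IsFree) (S : 𝒢.Scaffolding),
        SerreGraph.ActionIso ρ S.treeAction.range.subtype) := by
  have h12 : (∃ (D : LocalActionDiagram.{u}) (S : D.Tree),
        SerreGraph.ActionIso ρ S.universalGroup.subtype) →
      ∃ (𝒢 : GraphOfGroupActions.{u}) (_ : 𝒢.IsFree) (S : 𝒢.Scaffolding),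
        SerreGraph.ActionIso ρ S.treeAction := by
    rintro ⟨D, S, h⟩
    exact ⟨D.toGraphOfGroupActions, D.toGraphOfGroupActions_isFree, S.toScaffolding,
      h.trans S.actionIso_treeAction⟩
  have h23 : (∃ (𝒢 : GraphOfGroupActions.{u}) (_ : 𝒢.IsFree) (S : 𝒢.Scaffolding),
        SerreGraph.ActionIso ρ S.treeAction) →
      ∃ (𝒢 : GraphOfGroupActions.{u}) (_ : 𝒢.IsFree) (S : 𝒢.Scaffolding),
        SerreGraph.ActionIso ρ S.treeAction.range.subtype := by
    rintro ⟨𝒢, h𝒢, S, h⟩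
    exact ⟨𝒢, h𝒢, S, h.rangeRestrict hρ⟩
  have h31 : (∃ (𝒢 : GraphOfGroupActions.{u}) (_ : 𝒢.IsFree) (S : 𝒢.Scaffolding),
        SerreGraph.ActionIso ρ S.treeAction.range.subtype) →
      ∃ (D : LocalActionDiagram.{u}) (S : D.Tree),
        SerreGraph.ActionIso ρ S.universalGroup.subtype := by
    rintro ⟨𝒢, h𝒢, S, h⟩
    exact ⟨𝒢.toLocalActionDiagram, S.toTree h𝒢, S.actionIso_toTree h𝒢 h⟩
  exact ⟨⟨h12, h31 ∘ h23⟩, ⟨h23 ∘ h12, h31⟩⟩
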